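/- Let $\lambda$ be Lebesgue measure, let $\alpha_1,\ldots,\alpha_m\in(0,1)$ and let $f:[0,1]^m\to\mathbb{C}$ be an integrable function. (1) If $\sum_{i=1}^m\alpha_i<1$, then $$\int_{A_1\times\cdots\times A_m} f = 0$$ for all pairwise disjoint measurable sets $A_1,\ldots,A_m\subseteq[0,1]$ with $\lambda(A_i)=\alpha_i$ for $i=1,\ldots,m$ if and only if $f=0$ almost everywhere. (2) The same equivalence holds if $f$ is symmetric (that is, for every permutation $\sigma$ of $\{1,\ldots,m\}$, $f(x_{\sigma(1)},\ldots,x_{\sigma(m)})=f(x_1,\ldots,x_m)$ for almost every $x\in[0,1]^m$), $\sum_{i=1}^m\alpha_i=1$, and $(\alpha_1,\ldots,\alpha_m)\neq(1/m,\ldots,1/m)$. -/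

import Mathlib

open MeasureTheory unitInterval

/-- The integral of `f` over `A 0 × ⋯ × A (m - 1)` vanishes for all pairwise disjoint measurable
sets `A i ⊆ [0,1]` of Lebesgue measures `α i`. -/
def VanishesOnDisjointProducts {m : ℕ} (α : Fin m → ℝ) (f : (Fin m → I) → ℂ) : Prop :=
  ∀ A : Fin m → Set I, (∀ i, MeasurableSet (A i)) →
    (∀ i j, i ≠ j → Disjoint (A i) (A j)) →
    (∀ i, volume (A i) = ENNReal.ofReal (α i)) →
    ∫ x in Set.univ.pi A, f x = 0

/-- `f` is invariant under permutations of the coordinates. Equality of functions is equality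
almost everywhere. -/
def IsSymmetricFun {m : ℕ} (f : (Fin m → I) → ℂ) : Prop :=
  ∀ τ : Equiv.Perm (Fin m), (fun x : Fin m → I => f (fun i => x (τ i))) =ᵐ[volume] f

/-! Fix all the sets but one. The integral is then a set function of the remaining side, given by a
density. If the integrals of a density over all subsets of one measure `s` of a domain larger than
`s` agree, it is constant there: exchange two small pieces of such a subset. When the `α i` sum to
less than one there is room for this, the constant is zero, and the side may be replaced by any
small set. Doing so in every coordinate makes `f` integrate to zero over all boxes with small
disjoint sides, which suffices since almost every point has distinct coordinates.

When the sum is one, no room is left. Choose `α i ≠ α j`, fix the other sets and let the two sides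
partition the complement; symmetry of `f` gives a symmetric form `F`. For small `P`, `Q` of equal
measure, `F P - F Q` is a multiple of Lebesgue measure away from `P ∪ Q`, with equal values on two
complementary sets of different measures, hence zero. So the `j`-th side may shrink, and the first
case applies. -/

/-! ### Functions on the interval with constant density -/

namespace unitInterval

/-- The Lebesgue measure of the unit interval takes all intermediate values. -/
theorem exists_subset_volume_real_eq {D : Set I} (hD : MeasurableSet D) {c : ℝ} (hc : 0 ≤ c)
    (hcD : c ≤ volume.real D) : ∃ B ⊆ D, MeasurableSet B ∧ volume.real B = c := by
  let φ : ℝ → ℝ := fun t => volume.real (D ∩ {x : I | (x : ℝ) ≤ t})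
  have hmeas : ∀ t : ℝ, MeasurableSet {x : I | (x : ℝ) ≤ t} := fun t =>
    measurableSet_le measurable_subtype_coe measurable_const
  have hlip : ∀ s t : ℝ, s ≤ t → |φ t - φ s| ≤ t - s := by
    intro s t hst
    have hsub : D ∩ {x : I | (x : ℝ) ≤ s} ⊆ D ∩ {x : I | (x : ℝ) ≤ t} := fun x hx =>
      ⟨hx.1, le_trans hx.2 hst⟩
    have h1 : φ t - φ s = volume.real
        ((D ∩ {x : I | (x : ℝ) ≤ t}) \ (D ∩ {x : I | (x : ℝ) ≤ s})) :=
      (measureReal_sdiff hsub (hD.inter (hmeas s))).symm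
    rw [h1, abs_of_nonneg measureReal_nonneg]
    calc _ ≤ volume.real ((Subtype.val : I → ℝ) ⁻¹' Set.Ioc s t) := by
          refine measureReal_mono ?_ (measure_ne_top _ _)
          rintro x ⟨⟨hx1, hx2⟩, hx3⟩
          refine ⟨?_, hx2⟩
          by_contra h
          exact hx3 ⟨hx1, not_lt.mp h⟩
      _ ≤ volume.real (Set.Ioc s t) := by
          refine ENNReal.toReal_mono (by simp) ?_
          rw [unitInterval.volume_def,
            (MeasurableEmbedding.subtype_coe measurableSet_Icc).comap_preimage]
          exact measure_mono Set.inter_subset_left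
      _ = t - s := by simp [hst]
  have hcont : Continuous φ := by
    refine (LipschitzWith.of_dist_le_mul (K := 1) fun s t => ?_).continuous
    rw [NNReal.coe_one, one_mul, Real.dist_eq, Real.dist_eq]
    rcases le_total s t with h | h
    · rw [abs_sub_comm, abs_sub_comm s t]
      exact (hlip s t h).trans (le_abs_self _)
    · exact (hlip t s h).trans (le_abs_self _)
  -- Starting at `-1` instead of `0` makes the set empty, not merely null.
  have h0 : φ (-1) = 0 := by
    have : D ∩ {x : I | (x : ℝ) ≤ -1} = ∅ := by
      ext x
      have := x.2.1
      simp only [Set.mem_inter_iff, Set.mem_ofPred_eq, Set.mem_empty_iff_false, iff_false, not_and,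
        not_le]
      intro _
      linarith
    simp [φ, this]
  have h1 : φ 1 = volume.real D := by
    have : D ∩ {x : I | (x : ℝ) ≤ 1} = D := Set.inter_eq_left.mpr fun x _ => x.2.2
    simp [φ, this]
  obtain ⟨t, -, ht⟩ := intermediate_value_Icc (by norm_num : (-1 : ℝ) ≤ 1) hcont.continuousOn
    (show c ∈ Set.Icc (φ (-1)) (φ 1) from ⟨h0 ▸ hc, h1 ▸ hcD⟩)
  exact ⟨_, Set.inter_subset_left, hD.inter (hmeas t), ht⟩

theorem setIntegral_eq_mul_of_le {g : I → ℝ} (hg : Integrable g) {D : Set I} {c : ℝ} (hcg : ∀ᵐ x ∂volume.restrict D, c ≤ g x)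
    (hc : ∫ x in D, g x = c * volume.real D) {B : Set I} (hBD : B ⊆ D) :
    ∫ x in B, g x = c * volume.real B := by
  have h0 : ∫ x in D, (g x - c) = 0 := by
    rw [integral_sub hg.integrableOn (integrable_const c), hc]
    simp [mul_comm]
  have h1 := (setIntegral_eq_zero_iff_of_nonneg_ae
    (hcg.mono fun x hx => sub_nonneg.mpr hx)
    (hg.integrableOn.sub (integrable_const c))).mp h0
  have h2 : g =ᵐ[volume.restrict B] fun _ => c := by
    refine (ae_restrict_of_ae_restrict_of_subset hBD h1).mono fun x hx => ?_
    exact sub_eq_zero.mp hx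
  rw [integral_congr_ae h2]
  simp [mul_comm]

theorem setIntegral_pos_of_pos {g : I → ℝ} (hg : Integrable g) {P : Set I}
    (hP : MeasurableSet P) (hpos : ∀ x ∈ P, 0 < g x) (h : 0 < volume.real P) :
    0 < ∫ x in P, g x := by
  rw [setIntegral_pos_iff_support_of_nonneg_ae
    ((ae_restrict_iff' hP).mpr (ae_of_all _ fun x hx => (hpos x hx).le)) hg.integrableOn]
  have : Function.support g ∩ P = P := Set.inter_eq_right.mpr fun x hx => (hpos x hx).ne'
  rw [this]
  exact (ENNReal.toReal_pos_iff.mp h).1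

/-- A function whose integrals over small disjoint subsets of `D` of equal measure agree is
constant almost everywhere on `D`. -/
theorem exists_setIntegral_eq_mul_of_real {g : I → ℝ} (hgm : Measurable g) (hg : Integrable g)
    {D : Set I} (hD : MeasurableSet D) {ε : ℝ} (hε : 0 < ε)
    (h : ∀ P ⊆ D, ∀ Q ⊆ D, MeasurableSet P → MeasurableSet Q → Disjoint P Q →
      volume.real P = volume.real Q → volume.real P ≤ ε → ∫ x in P, g x = ∫ x in Q, g x) :
    ∃ c : ℝ, ∀ B ⊆ D, ∫ x in B, g x = c * volume.real B := by
  let c : ℝ := (∫ x in D, g x) / volume.real D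
  have hc : ∫ x in D, g x = c * volume.real D := by
    by_cases h0 : volume.real D = 0
    · have : volume D = 0 := (measureReal_eq_zero_iff).mp h0
      rw [h0, mul_zero]
      exact setIntegral_measure_zero g this
    · simp only [c]
      field_simp
  refine ⟨c, fun B hBD => ?_⟩
  let L : Set I := D ∩ {x | g x < c}
  let U : Set I := D ∩ {x | c < g x}
  have hL : MeasurableSet L := hD.inter (measurableSet_lt hgm measurable_const)
  have hU : MeasurableSet U := hD.inter (measurableSet_lt measurable_const hgm)
  by_cases hL0 : volume.real L = 0
  · refine setIntegral_eq_mul_of_le hg ?_ hc hBD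
    have : volume L = 0 := (measureReal_eq_zero_iff).mp hL0
    rw [ae_restrict_iff' hD, ae_iff]
    refine measure_mono_null (fun x hx => ?_) this
    simpa [L, not_le] using hx
  by_cases hU0 : volume.real U = 0
  · have : ∫ x in B, -g x = -c * volume.real B := by
      refine setIntegral_eq_mul_of_le hg.neg ?_ ?_ hBD
      · have : volume U = 0 := (measureReal_eq_zero_iff).mp hU0
        rw [ae_restrict_iff' hD, ae_iff]
        refine measure_mono_null (fun x hx => ?_) this
        simpa [U, not_le] using hx
      · simp only [Pi.neg_apply]
        rw [integral_neg, hc, neg_mul]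
    rw [integral_neg] at this
    linarith
  exfalso
  -- With `c` the mean of `g`, sets of equal measure `δ` inside `L` and `U` have integrals below and
  -- above `c * δ`.
  let δ := min ε (min (volume.real L) (volume.real U))
  have hδ : 0 < δ := lt_min hε (lt_min (measureReal_nonneg.lt_of_ne' hL0)
    (measureReal_nonneg.lt_of_ne' hU0))
  obtain ⟨P, hPL, hPm, hP⟩ := exists_subset_volume_real_eq hL hδ.le
    ((min_le_right _ _).trans (min_le_left _ _))
  obtain ⟨Q, hQU, hQm, hQ⟩ := exists_subset_volume_real_eq hU hδ.le
    ((min_le_right _ _).trans (min_le_right _ _))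
  have hdisj : Disjoint P Q := Set.disjoint_left.mpr fun x hx hx' =>
    lt_asymm (show g x < c from (hPL hx).2) (hQU hx').2
  have heq := h P (fun x hx => (hPL hx).1) Q (fun x hx => (hQU hx).1) hPm hQm hdisj
    (hP.trans hQ.symm) (hP.trans_le (min_le_left _ _))
  have h1 := setIntegral_pos_of_pos (g := fun x => c - g x) ((integrable_const c).sub hg) hPm
    (fun x hx => sub_pos.mpr (hPL hx).2) (hP ▸ hδ)
  have h2 := setIntegral_pos_of_pos (g := fun x => g x - c) (hg.sub (integrable_const c)) hQm
    (fun x hx => sub_pos.mpr (hQU hx).2) (hQ ▸ hδ)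
  rw [integral_sub (integrable_const c) hg.integrableOn] at h1
  rw [integral_sub hg.integrableOn (integrable_const c)] at h2
  simp only [integral_const, smul_eq_mul, measureReal_restrict_apply_univ, hP, hQ] at h1 h2
  linarith

theorem exists_setIntegral_eq_mul {g : I → ℂ} (hgm : Measurable g) (hg : Integrable g)
    {D : Set I} (hD : MeasurableSet D) {ε : ℝ} (hε : 0 < ε)
    (h : ∀ P ⊆ D, ∀ Q ⊆ D, MeasurableSet P → MeasurableSet Q → Disjoint P Q →
      volume.real P = volume.real Q → volume.real P ≤ ε → ∫ x in P, g x = ∫ x in Q, g x) :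
    ∃ c : ℂ, ∀ B ⊆ D, ∫ x in B, g x = c * volume.real B := by
  have hre : ∀ B, ∫ x in B, (g x).re = (∫ x in B, g x).re := fun B =>
    integral_re hg.integrableOn
  have him : ∀ B, ∫ x in B, (g x).im = (∫ x in B, g x).im := fun B =>
    integral_im hg.integrableOn
  obtain ⟨a, ha⟩ := exists_setIntegral_eq_mul_of_real (g := fun x => (g x).re) hgm.re hg.re hD hε
    (fun P hP Q hQ hPm hQm hd he hs => by rw [hre, hre, h P hP Q hQ hPm hQm hd he hs])
  obtain ⟨b, hb⟩ := exists_setIntegral_eq_mul_of_real (g := fun x => (g x).im) hgm.im hg.im hD hε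
    (fun P hP Q hQ hPm hQm hd he hs => by rw [him, him, h P hP Q hQ hPm hQm hd he hs])
  refine ⟨⟨a, b⟩, fun B hB => Complex.ext ?_ ?_⟩
  · rw [← hre, ha B hB]
    simp
  · rw [← him, hb B hB]
    simp

/-- A function whose integrals over all subsets of `D` of a fixed measure agree is constant
almost everywhere on `D`. -/
theorem exists_setIntegral_eq_mul_of_const {g : I → ℂ} (hgm : Measurable g) (hg : Integrable g)
    {D : Set I} (hD : MeasurableSet D) {s : ℝ} (hs : 0 < s) (hsD : s < volume.real D) {v : ℂ}
    (h : ∀ S ⊆ D, MeasurableSet S → volume.real S = s → ∫ x in S, g x = v) :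
    ∃ c : ℂ, ∀ B ⊆ D, ∫ x in B, g x = c * volume.real B := by
  refine exists_setIntegral_eq_mul hgm hg hD (lt_min hs (sub_pos.mpr hsD))
    fun P hP Q hQ hPm hQm hd he hp => ?_
  have hps := hp.trans (min_le_left _ _)
  have hpD := hp.trans (min_le_right _ _)
  have hE : volume.real (D \ (P ∪ Q)) = volume.real D - 2 * volume.real P := by
    rw [measureReal_sdiff (Set.union_subset hP hQ) (hPm.union hQm), measureReal_union hd hQm, ← he]
    ring
  -- A common remainder completes both `P` and `Q` to measure `s`; it fits because `P` has measure
  -- at most `volume.real D - s`.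
  obtain ⟨R, hRD, hRm, hR⟩ := exists_subset_volume_real_eq (hD.diff (hPm.union hQm))
    (sub_nonneg.mpr hps) (by rw [hE]; linarith)
  have hPR : Disjoint P R := Set.disjoint_left.mpr fun x hx hx' => (hRD hx').2 (Or.inl hx)
  have hQR : Disjoint Q R := Set.disjoint_left.mpr fun x hx hx' => (hRD hx').2 (Or.inr hx)
  have hR' : R ⊆ D := fun x hx => (hRD hx).1
  have h1 := h (P ∪ R) (Set.union_subset hP hR') (hPm.union hRm)
    (by rw [measureReal_union hPR hRm, hR]; ring)
  have h2 := h (Q ∪ R) (Set.union_subset hQ hR') (hQm.union hRm)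
    (by rw [measureReal_union hQR hRm, hR, he]; ring)
  rw [setIntegral_union hPR hRm hg.integrableOn hg.integrableOn] at h1
  rw [setIntegral_union hQR hRm hg.integrableOn hg.integrableOn] at h2
  exact add_right_cancel (h1.trans h2.symm)

end unitInterval

/-! ### Densities and boxes with disjoint sides -/

namespace MeasureTheory

/-- The integral of a function over the preimages of sets under a measure preserving map is given
by a density. -/
theorem MeasurePreserving.exists_setIntegral_preimage_eq {X Y : Type*} [mX : MeasurableSpace X]
    [MeasurableSpace Y] {μ : Measure X} {ν : Measure Y} [IsFiniteMeasure μ] {φ : X → Y}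
    (hφ : MeasurePreserving φ μ ν) {h : X → ℂ} (hh : Integrable h μ) :
    ∃ g : Y → ℂ, Measurable g ∧ Integrable g ν ∧
      ∀ B, MeasurableSet B → ∫ y in B, g y ∂ν = ∫ x in φ ⁻¹' B, h x ∂μ := by
  have hle : MeasurableSpace.comap φ inferInstance ≤ mX := hφ.measurable.comap_le
  -- The conditional expectation of `h` given `φ` factors through `φ`; the factor is the density.
  obtain ⟨g, hgm, hg⟩ := Measurable.exists_eq_measurable_comp (f := φ)
    (stronglyMeasurable_condExp (μ := μ) (f := h)
      (m := MeasurableSpace.comap φ inferInstance)).measurable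
  have hgi : Integrable (g ∘ φ) μ := hg ▸ integrable_condExp
  refine ⟨g, hgm, (hφ.integrable_comp hgm.aestronglyMeasurable).mp hgi, fun B hB => ?_⟩
  rw [← setIntegral_condExp hle hh ⟨B, hB, rfl⟩, hg]
  rw [← hφ.map_eq, setIntegral_map hB hgm.aestronglyMeasurable hφ.measurable.aemeasurable]
  rfl

/-- If the integral of `h` vanishes on all measurable boxes, then `h` vanishes almost
everywhere. -/
theorem Integrable.ae_eq_zero_of_forall_setIntegral_pi_eq_zero {ι : Type*} [Fintype ι]
    {X : ι → Type*} [∀ i, MeasurableSpace (X i)] {μ : Measure (∀ i, X i)}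
    {h : (∀ i, X i) → ℂ} (hh : Integrable h μ)
    (hbox : ∀ B : ∀ i, Set (X i), (∀ i, MeasurableSet (B i)) →
      ∫ x in Set.univ.pi B, h x ∂μ = 0) :
    h =ᵐ[μ] 0 := by
  have huniv : ∫ x, h x ∂μ = 0 := by
    simpa using hbox (fun _ => Set.univ) (fun _ => MeasurableSet.univ)
  have key : ∀ S, MeasurableSet S → ∫ x in S, h x ∂μ = 0 := by
    intro S hS
    refine MeasurableSpace.induction_on_inter (C := fun S _ => ∫ x in S, h x ∂μ = 0)
      generateFrom_pi.symm isPiSystem_pi ?_ ?_ ?_ ?_ S hS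
    · simp
    · rintro t ⟨B, hB, rfl⟩
      exact hbox B fun i => hB i (Set.mem_univ i)
    · intro t ht iht
      rw [setIntegral_compl ht hh, huniv, iht, sub_zero]
    · intro F hd hF ihF
      rw [integral_iUnion hF hd hh.integrableOn]
      simp [ihF]
  exact hh.ae_eq_zero_of_forall_setIntegral_eq_zero fun S hS _ => key S hS

/-- Two coordinates are independent, so their joint law is `μ.prod μ`, for which the diagonal is
null. -/
theorem ae_injective_pi {ι X : Type*} [Fintype ι] [MeasurableSpace X] [MeasurableEq X]
    (μ : Measure X) [IsProbabilityMeasure μ] [NullSingletonClass μ] :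
    ∀ᵐ x : ι → X ∂Measure.pi (fun _ => μ), Function.Injective x := by
  have key : ∀ i j : ι, i ≠ j → ∀ᵐ x : ι → X ∂Measure.pi (fun _ => μ), x i ≠ x j := by
    intro i j hij
    have hind := (ProbabilityTheory.iIndepFun_pi (μ := fun _ : ι => μ) (X := fun _ : ι => id)
      (fun _ => aemeasurable_id)).indepFun hij
    simp only [id] at hind
    rw [ProbabilityTheory.indepFun_iff_map_prod_eq_prod_map_map
      (measurable_pi_apply i).aemeasurable (measurable_pi_apply j).aemeasurable] at hind
    have hi := (measurePreserving_eval (fun _ : ι => μ) i).map_eq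
    have hj := (measurePreserving_eval (fun _ : ι => μ) j).map_eq
    have hd : (μ.prod μ) (Set.diagonal X) = 0 := by
      rw [Measure.measure_prod_null measurableSet_diagonal]
      refine ae_of_all _ fun x => ?_
      have : Prod.mk x ⁻¹' Set.diagonal X = {x} := by
        ext y
        simp [eq_comm]
      change μ (Prod.mk x ⁻¹' Set.diagonal X) = 0
      rw [this]
      exact measure_singleton x
    have hmap : Measure.map (fun x : ι → X => (x i, x j)) (Measure.pi fun _ => μ) = μ.prod μ := by
      rw [hind]
      congr 1
    rw [← hmap, Measure.map_apply
      ((measurable_pi_apply i).prodMk (measurable_pi_apply j)) measurableSet_diagonal] at hd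
    rw [ae_iff]
    convert hd using 2
    ext x
    simp
  have := (ae_all_iff (ι := ι)).mpr fun i => (ae_all_iff (ι := ι)).mpr fun j =>
    show ∀ᵐ x : ι → X ∂Measure.pi (fun _ => μ), i ≠ j → x i ≠ x j by
      by_cases hij : i = j
      · exact ae_of_all _ fun x h => absurd hij h
      · exact (key i j hij).mono fun x hx _ => hx
  filter_upwards [this] with x hx i j hij
  by_contra h
  exact hx i j h hij

/-- If the integral of `f` vanishes on all boxes with small pairwise disjoint sides, then `f`
vanishes almost everywhere. -/
theorem Integrable.ae_eq_zero_of_forall_disjoint_pi {ι X : Type*} [Fintype ι]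
    [TopologicalSpace X] [SecondCountableTopology X] [T2Space X] [MeasurableSpace X]
    [BorelSpace X] {μ : Measure X} [IsProbabilityMeasure μ] [NullSingletonClass μ]
    [μ.OuterRegular]
    {f : (ι → X) → ℂ} (hf : Integrable f (Measure.pi fun _ => μ)) {ε : ℝ} (hε : 0 < ε)
    (h : ∀ A : ι → Set X, (∀ i, MeasurableSet (A i)) → (∀ i j, i ≠ j → Disjoint (A i) (A j)) →
      (∀ i, μ.real (A i) ≤ ε) → ∫ x in Set.univ.pi A, f x ∂Measure.pi (fun _ => μ) = 0) :
    f =ᵐ[Measure.pi fun _ => μ] 0 := by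
  -- Sub-boxes of a box with small disjoint sides are of the same kind, and only countably many
  -- basic boxes are needed.
  have hbox : ∀ u : ι → TopologicalSpace.countableBasis X,
      (∀ i j, i ≠ j → Disjoint (u i : Set X) (u j)) → (∀ i, μ.real (u i : Set X) ≤ ε) →
      ∀ᵐ x ∂Measure.pi (fun _ => μ), x ∈ Set.univ.pi (fun i => (u i : Set X)) → f x = 0 := by
    intro u hd hs
    have hum : ∀ i, MeasurableSet (u i : Set X) := fun i =>
      (TopologicalSpace.isOpen_of_mem_countableBasis (u i).2).measurableSet
    have hpm : MeasurableSet (Set.univ.pi fun i => (u i : Set X)) :=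
      MeasurableSet.univ_pi hum
    rw [← ae_restrict_iff' hpm]
    refine (hf.restrict (s := Set.univ.pi fun i =>
      (u i : Set X))).ae_eq_zero_of_forall_setIntegral_pi_eq_zero fun B hB => ?_
    rw [Measure.restrict_restrict (MeasurableSet.univ_pi hB), ← Set.pi_inter_distrib]
    refine h _ (fun i => (hB i).inter (hum i)) (fun i j hij => ?_) fun i => ?_
    · exact (hd i j hij).mono Set.inter_subset_right Set.inter_subset_right
    · exact (measureReal_mono Set.inter_subset_right).trans (hs i)
  have : Countable (TopologicalSpace.countableBasis X) :=
    (TopologicalSpace.countable_countableBasis X).to_subtype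
  have hall := (ae_all_iff (ι := ι → TopologicalSpace.countableBasis X)).mpr fun u =>
    show ∀ᵐ x ∂Measure.pi (fun _ => μ),
      ((∀ i j, i ≠ j → Disjoint (u i : Set X) (u j)) ∧ (∀ i, μ.real (u i : Set X) ≤ ε)) →
      x ∈ Set.univ.pi (fun i => (u i : Set X)) → f x = 0 by
      by_cases hu : (∀ i j, i ≠ j → Disjoint (u i : Set X) (u j)) ∧
        (∀ i, μ.real (u i : Set X) ≤ ε)
      · exact (hbox u hu.1 hu.2).mono fun x hx _ => hx
      · exact ae_of_all _ fun x hx => absurd hx hu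
  filter_upwards [hall, ae_injective_pi μ] with x hx hinj
  obtain ⟨V, hV, hVd⟩ := (Set.finite_range x).t2_separation
  have hsmall : ∀ i, ∃ W : Set X, IsOpen W ∧ x i ∈ W ∧ μ.real W ≤ ε := fun i => by
    obtain ⟨W, hW, hWo, hWε⟩ := Set.exists_isOpen_lt_of_lt {x i} (ENNReal.ofReal ε)
      (μ := μ) (by simpa using hε)
    exact ⟨W, hWo, hW rfl, ENNReal.toReal_le_of_le_ofReal hε.le hWε.le⟩
  choose W hWo hxW hWε using hsmall
  have hu : ∀ i, ∃ v ∈ TopologicalSpace.countableBasis X, x i ∈ v ∧ v ⊆ V (x i) ∩ W i := fun i =>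
    (TopologicalSpace.isBasis_countableBasis X).exists_subset_of_mem_open
      ⟨(hV (x i)).1, hxW i⟩ ((hV (x i)).2.inter (hWo i))
  choose v hv hxv hvs using hu
  refine hx (fun i => ⟨v i, hv i⟩) ⟨fun i j hij => ?_, fun i => ?_⟩ fun i _ => hxv i
  · exact (hVd ⟨i, rfl⟩ ⟨j, rfl⟩ (hinj.ne hij)).mono
      ((hvs i).trans Set.inter_subset_left) ((hvs j).trans Set.inter_subset_left)
  · exact (measureReal_mono ((hvs i).trans Set.inter_subset_right)).trans (hWε i)

/-- The integral over a box, as a function of one of its sides, is given by a density. -/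
theorem Integrable.exists_setIntegral_pi_update_eq {ι X : Type*} [Fintype ι] [DecidableEq ι]
    [MeasurableSpace X] {μ : Measure X} [IsProbabilityMeasure μ] {f : (ι → X) → ℂ}
    (hf : Integrable f (Measure.pi fun _ => μ)) {A : ι → Set X} (hA : ∀ i, MeasurableSet (A i))
    (k : ι) :
    ∃ g : X → ℂ, Measurable g ∧ Integrable g μ ∧ ∀ B, MeasurableSet B →
      ∫ x in Set.univ.pi (Function.update A k B), f x ∂Measure.pi (fun _ => μ) =
        ∫ y in B, g y ∂μ := by
  have hC : MeasurableSet (Set.univ.pi (Function.update A k Set.univ)) :=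
    MeasurableSet.univ_pi fun i => by
      rcases eq_or_ne i k with rfl | hi
      · simp
      · simpa [hi] using hA i
  obtain ⟨g, hgm, hgi, hg⟩ :=
    (measurePreserving_eval (fun _ : ι => μ) k).exists_setIntegral_preimage_eq (hf.indicator hC)
  refine ⟨g, hgm, hgi, fun B hB => ?_⟩
  rw [hg B hB, setIntegral_indicator hC]
  congr 2
  ext x
  simp only [Set.mem_univ_pi, Set.mem_inter_iff, Set.mem_preimage, Function.eval]
  constructor
  · intro hx
    refine ⟨by simpa using hx k, fun i => ?_⟩
    rcases eq_or_ne i k with rfl | hi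
    · simp
    · simpa [hi] using hx i
  · rintro ⟨hk, hx⟩ i
    rcases eq_or_ne i k with rfl | hi
    · simpa using hk
    · simpa [hi] using hx i

end MeasureTheory

/-! ### Total measure below one -/

theorem disjoint_update_of_disjoint {ι X : Type*} [DecidableEq ι] {A : ι → Set X} {k : ι}
    {B : Set X} (hA : ∀ i j, i ≠ j → i ≠ k → j ≠ k → Disjoint (A i) (A j))
    (hB : ∀ j, j ≠ k → Disjoint B (A j)) (i j : ι) (hij : i ≠ j) :
    Disjoint (Function.update A k B i) (Function.update A k B j) := by
  rcases eq_or_ne i k with rfl | hi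
  · simpa [hij.symm] using hB j hij.symm
  · rcases eq_or_ne j k with rfl | hj
    · simpa [hi] using (hB i hi).symm
    · simpa [hi, hj] using hA i j hij hi hj

theorem measurableSet_update {ι X : Type*} [DecidableEq ι] [MeasurableSpace X] {A : ι → Set X}
    {k : ι} {B : Set X} (hA : ∀ i, i ≠ k → MeasurableSet (A i)) (hB : MeasurableSet B) (i : ι) :
    MeasurableSet (Function.update A k B i) := by
  rcases eq_or_ne i k with rfl | hi
  · simpa using hB
  · simpa [hi] using hA i hi

theorem VanishesOnDisjointProducts.setIntegral_eq_zero {m : ℕ} {α : Fin m → ℝ}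
    {f : (Fin m → I) → ℂ} (h : VanishesOnDisjointProducts α f) {A : Fin m → Set I}
    (hA : ∀ i, MeasurableSet (A i)) (hd : ∀ i j, i ≠ j → Disjoint (A i) (A j))
    (hv : ∀ i, volume.real (A i) = α i) : ∫ x in Set.univ.pi A, f x = 0 :=
  h A hA hd fun i => by rw [← hv i, ofReal_measureReal]

theorem vanishesOnDisjointProducts_of_ae_eq_zero {m : ℕ} {α : Fin m → ℝ}
    {f : (Fin m → I) → ℂ} (h : f =ᵐ[volume] 0) : VanishesOnDisjointProducts α f := by
  intro A _ _ _
  rw [integral_congr_ae (ae_restrict_of_ae h)]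
  simp

/-- Induction frees one coordinate at a time: those in `s` have small sides, the others still have
measure `α i`. -/
theorem VanishesOnDisjointProducts.setIntegral_eq_zero_of_small {m : ℕ} {α : Fin m → ℝ}
    (hα : ∀ i, 0 < α i) {f : (Fin m → I) → ℂ} (hf : Integrable f volume) {ε : ℝ} (hε : 0 < ε)
    (hsum : ∑ i, (α i + ε) < 1) (h : VanishesOnDisjointProducts α f) (s : Finset (Fin m)) :
    ∀ A : Fin m → Set I, (∀ i, MeasurableSet (A i)) → (∀ i j, i ≠ j → Disjoint (A i) (A j)) →
      (∀ i ∈ s, volume.real (A i) ≤ ε) → (∀ i ∉ s, volume.real (A i) = α i) →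
      ∫ x in Set.univ.pi A, f x = 0 := by
  induction s using Finset.induction_on with
  | empty => exact fun A hA hd _ hv => h.setIntegral_eq_zero hA hd fun i => hv i (by simp)
  | insert k s hk ih =>
    intro A hA hd hsmall hv
    obtain ⟨g, hgm, hgi, hg⟩ := hf.exists_setIntegral_pi_update_eq hA k
    let E : Set I := ⋃ j ∈ Finset.univ.erase k, A j
    have hE : MeasurableSet E := Finset.measurableSet_biUnion _ fun j _ => hA j
    have hEle : volume.real E ≤ ∑ j ∈ Finset.univ.erase k, (α j + ε) := by
      refine (measureReal_biUnion_finset_le _ _).trans (Finset.sum_le_sum fun j hj => ?_)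
      by_cases hjs : j ∈ s
      · linarith [hsmall j (Finset.mem_insert_of_mem hjs), hα j]
      · rw [hv j (by simp [hjs, Finset.ne_of_mem_erase hj])]
        linarith
    have hsplit := Finset.add_sum_erase Finset.univ (fun j => α j + ε) (Finset.mem_univ k)
    -- The strict inequality is the spare room that the exchange argument needs.
    have hD : α k < volume.real Eᶜ := by
      rw [probReal_compl_eq_one_sub hE]
      linarith
    have hdisj : ∀ B ⊆ Eᶜ, ∀ j, j ≠ k → Disjoint B (A j) := fun B hB j hj =>
      Set.disjoint_left.mpr fun x hx hxj =>
        hB hx (Set.mem_biUnion (Finset.mem_coe.mpr (Finset.mem_erase.mpr ⟨hj, Finset.mem_univ j⟩))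
          hxj)
    have hzero : ∀ S ⊆ Eᶜ, MeasurableSet S → volume.real S = α k → ∫ x in S, g x = 0 := by
      intro S hS hSm hSv
      rw [← hg S hSm]
      refine ih _ (measurableSet_update (fun i _ => hA i) hSm)
        (disjoint_update_of_disjoint (fun i j hij _ _ => hd i j hij) (hdisj S hS))
        (fun i hi => ?_) fun i hi => ?_
      · have hik : i ≠ k := fun hik => hk (hik ▸ hi)
        simpa [hik] using hsmall i (Finset.mem_insert_of_mem hi)
      · rcases eq_or_ne i k with rfl | hik
        · simpa using hSv
        · simpa [hik] using hv i (by simp [hi, hik])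
    obtain ⟨c, hc⟩ := exists_setIntegral_eq_mul_of_const hgm hgi hE.compl (hα k) hD hzero
    obtain ⟨S, hSE, hSm, hS⟩ := exists_subset_volume_real_eq hE.compl (hα k).le hD.le
    have hc0 : c = 0 := by
      have := hc S hSE
      rw [hzero S hSE hSm hS, hS, eq_comm, mul_eq_zero] at this
      exact this.resolve_right (by exact_mod_cast (hα k).ne')
    have hAk : A k ⊆ Eᶜ := fun x hx hxE => by
      obtain ⟨j, hj, hxj⟩ := Set.mem_iUnion₂.mp hxE
      exact Set.disjoint_left.mp (hd k j (Finset.ne_of_mem_erase hj).symm) hx hxj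
    have := hg (A k) (hA k)
    rwa [Function.update_eq_self, hc _ hAk, hc0, zero_mul] at this

theorem VanishesOnDisjointProducts.ae_eq_zero {m : ℕ} {α : Fin m → ℝ} (hα : ∀ i, 0 < α i)
    {f : (Fin m → I) → ℂ} (hf : Integrable f volume) (hsum : ∑ i, α i < 1)
    (h : VanishesOnDisjointProducts α f) : f =ᵐ[volume] 0 := by
  have hm : (0 : ℝ) < m + 1 := by positivity
  -- Dividing by `m + 1` keeps the inequality strict and covers `m = 0`.
  let ε : ℝ := (1 - ∑ i, α i) / (m + 1)
  have hε : 0 < ε := div_pos (sub_pos.mpr hsum) hm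
  have hε' : ∑ i, (α i + ε) < 1 := by
    have h1 : ε * (m + 1) = 1 - ∑ i, α i := div_mul_cancel₀ _ hm.ne'
    rw [Finset.sum_add_distrib]
    simp only [Finset.sum_const, Finset.card_univ, Fintype.card_fin, nsmul_eq_mul]
    linarith
  exact Integrable.ae_eq_zero_of_forall_disjoint_pi (μ := (volume : Measure I)) hf hε
    fun A hA hd hs => h.setIntegral_eq_zero_of_small hα hf hε hε' Finset.univ A hA hd
      (fun i _ => hs i) fun i hi => absurd (Finset.mem_univ i) hi

/-! ### Symmetric functions and total measure one -/

theorem IsSymmetricFun.setIntegral_pi_comp {m : ℕ} {f : (Fin m → I) → ℂ} (h : IsSymmetricFun f)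
    (τ : Equiv.Perm (Fin m)) (A : Fin m → Set I) :
    ∫ x in Set.univ.pi (fun i => A (τ i)), f x = ∫ x in Set.univ.pi A, f x := by
  let e := MeasurableEquiv.piCongrLeft (fun _ : Fin m => I) τ.symm
  have he : ∀ x : Fin m → I, e x = fun i => x (τ i) := fun x => by
    ext i
    have := MeasurableEquiv.piCongrLeft_apply_apply (β := fun _ : Fin m => I) τ.symm x (τ i)
    rw [Equiv.symm_apply_apply] at this
    exact congrArg _ this
  have hp : MeasurePreserving e volume volume :=
    volume_measurePreserving_piCongrLeft (fun _ : Fin m => I) τ.symm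
  rw [← hp.setIntegral_preimage_emb e.measurableEmbedding]
  have hpre : e ⁻¹' Set.univ.pi (fun i => A (τ i)) = Set.univ.pi A := by
    ext x
    simp only [Set.mem_preimage, Set.mem_univ_pi, he]
    exact ⟨fun hx i => by simpa using hx (τ.symm i), fun hx i => hx (τ i)⟩
  rw [hpre]
  refine integral_congr_ae (ae_restrict_of_ae ((h τ).mono fun x hx => ?_))
  simp only [he]
  exact hx

/-- A symmetric biadditive set function with densities that vanishes on all partitions of `D`
into sets of measures `a ≠ b` vanishes on all disjoint pairs whose first set has measure `a`. -/
theorem eq_zero_of_vanishes_on_partitions {D : Set I} (hD : MeasurableSet D) {a b : ℝ}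
    (ha : 0 < a) (hb : 0 < b) (hab : a ≠ b) (hDv : volume.real D = a + b)
    {F : Set I → Set I → ℂ} (hsymm : ∀ B C, F B C = F C B)
    (hdens : ∀ B, MeasurableSet B → ∃ g : I → ℂ, Measurable g ∧ Integrable g ∧
      ∀ C, MeasurableSet C → F B C = ∫ x in C, g x)
    (h0 : ∀ B ⊆ D, MeasurableSet B → volume.real B = a → F B (D \ B) = 0)
    {U P : Set I} (hUD : U ⊆ D) (hUm : MeasurableSet U) (hU : volume.real U = a)
    (hPU : P ⊆ D \ U) (hPm : MeasurableSet P) : F U P = 0 := by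
  have hadd : ∀ B C C', MeasurableSet B → MeasurableSet C → MeasurableSet C' → Disjoint C C' →
      F B (C ∪ C') = F B C + F B C' := by
    intro B C C' hB hC hC' hd
    obtain ⟨g, -, hgi, hg⟩ := hdens B hB
    rw [hg _ hC, hg _ hC', hg _ (hC.union hC'),
      setIntegral_union hd hC' hgi.integrableOn hgi.integrableOn]
  have hadd' : ∀ B B' C, MeasurableSet B → MeasurableSet B' → MeasurableSet C → Disjoint B B' →
      F (B ∪ B') C = F B C + F B' C := by
    intro B B' C hB hB' hC hd
    rw [hsymm, hadd C B B' hC hB hB' hd, hsymm C, hsymm C]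
  have hswap : ∀ P ⊆ D, ∀ Q ⊆ D, MeasurableSet P → MeasurableSet Q → Disjoint P Q →
      volume.real P = volume.real Q → volume.real P ≤ min a b / 2 →
      ∀ V ⊆ D \ (P ∪ Q), MeasurableSet V → F P V = F Q V := by
    intro P hP Q hQ hPm hQm hPQ hpq hp V hV hVm
    have hpa : volume.real P < a := by linarith [min_le_left a b]
    have hpb : volume.real P < b := by linarith [min_le_right a b]
    let D' := D \ (P ∪ Q)
    have hD'm : MeasurableSet D' := hD.diff (hPm.union hQm)
    have hD' : volume.real D' = a + b - 2 * volume.real P := by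
      rw [measureReal_sdiff (Set.union_subset hP hQ) (hPm.union hQm), measureReal_union hPQ hQm,
        ← hpq, hDv]
      ring
    obtain ⟨g₁, hg₁m, hg₁i, hg₁⟩ := hdens P hPm
    obtain ⟨g₂, hg₂m, hg₂i, hg₂⟩ := hdens Q hQm
    have hG : ∀ B, MeasurableSet B → ∫ x in B, (g₁ x - g₂ x) = F P B - F Q B := fun B hB => by
      rw [integral_sub hg₁i.integrableOn hg₂i.integrableOn, hg₁ B hB, hg₂ B hB]
    -- Expand `F` on the partitions `P ∪ S`, `Q ∪ T` and `Q ∪ S`, `P ∪ T`, where `T = D' \ S`, and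
    -- subtract: `F P Q` and `F S T` cancel.
    have hcompl : ∀ S ⊆ D', MeasurableSet S → volume.real S = a - volume.real P →
        F P (D' \ S) - F Q (D' \ S) = F P S - F Q S := by
      intro S hS hSm hSv
      have hTm : MeasurableSet (D' \ S) := hD'm.diff hSm
      have hPS : Disjoint P S := Set.disjoint_left.mpr fun x hx hx' => (hS hx').2 (Or.inl hx)
      have hQS : Disjoint Q S := Set.disjoint_left.mpr fun x hx hx' => (hS hx').2 (Or.inr hx)
      have hPT : Disjoint P (D' \ S) :=
        Set.disjoint_left.mpr fun x hx hx' => hx'.1.2 (Or.inl hx)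
      have hQT : Disjoint Q (D' \ S) :=
        Set.disjoint_left.mpr fun x hx hx' => hx'.1.2 (Or.inr hx)
      have hSD : S ⊆ D := fun x hx => (hS hx).1
      have e1 : D \ (P ∪ S) = Q ∪ D' \ S := by
        ext x
        have h1 : x ∈ P → x ∉ Q := fun h => Set.disjoint_left.mp hPQ h
        have h2 : x ∈ Q → x ∉ S := fun h => Set.disjoint_left.mp hQS h
        have h3 : x ∈ Q → x ∈ D := fun h => hQ h
        simp only [D', Set.mem_sdiff, Set.mem_union]
        tauto
      have e2 : D \ (Q ∪ S) = P ∪ D' \ S := by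
        ext x
        have h1 : x ∈ P → x ∉ Q := fun h => Set.disjoint_left.mp hPQ h
        have h2 : x ∈ P → x ∉ S := fun h => Set.disjoint_left.mp hPS h
        have h3 : x ∈ P → x ∈ D := fun h => hP h
        simp only [D', Set.mem_sdiff, Set.mem_union]
        tauto
      have z1 := h0 (P ∪ S) (Set.union_subset hP hSD) (hPm.union hSm)
        (by rw [measureReal_union hPS hSm, hSv]; ring)
      have z2 := h0 (Q ∪ S) (Set.union_subset hQ hSD) (hQm.union hSm)
        (by rw [measureReal_union hQS hSm, hSv, hpq]; ring)
      rw [e1, hadd' _ _ _ hPm hSm (hQm.union hTm) hPS, hadd _ _ _ hPm hQm hTm hQT,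
        hadd _ _ _ hSm hQm hTm hQT, hsymm S Q] at z1
      rw [e2, hadd' _ _ _ hQm hSm (hPm.union hTm) hQS, hadd _ _ _ hQm hPm hTm hPT,
        hadd _ _ _ hSm hPm hTm hPT, hsymm S P, hsymm Q P] at z2
      linear_combination z1 - z2
    have hSconst : ∀ S ⊆ D', MeasurableSet S → volume.real S = a - volume.real P →
        ∫ x in S, (g₁ x - g₂ x) = (∫ x in D', (g₁ x - g₂ x)) / 2 := by
      intro S hS hSm hSv
      have h1 := hcompl S hS hSm hSv
      have h2 : ∫ x in D', (g₁ x - g₂ x) =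
          (∫ x in S, (g₁ x - g₂ x)) + ∫ x in D' \ S, (g₁ x - g₂ x) := by
        have hgi : Integrable fun x => g₁ x - g₂ x := hg₁i.sub hg₂i
        rw [← setIntegral_union Set.disjoint_sdiff_right (hD'm.diff hSm) hgi.integrableOn
          hgi.integrableOn, Set.union_sdiff_cancel hS]
      rw [h2, hG _ hSm, hG _ (hD'm.diff hSm), h1]
      ring
    have hsD : a - volume.real P < volume.real D' := by
      rw [hD']
      linarith
    obtain ⟨c, hc⟩ := exists_setIntegral_eq_mul_of_const (hg₁m.sub hg₂m) (hg₁i.sub hg₂i) hD'm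
      (sub_pos.mpr hpa) hsD hSconst
    obtain ⟨S, hS, hSm, hSv⟩ := exists_subset_volume_real_eq hD'm (sub_pos.mpr hpa).le hsD.le
    have hTv : volume.real (D' \ S) = b - volume.real P := by
      rw [measureReal_sdiff hS hSm, hD', hSv]
      ring
    have h1 := hc S hS
    have h2 := hc (D' \ S) Set.sdiff_subset
    simp only [Pi.sub_apply] at h1 h2 hc
    rw [hG _ hSm, hSv] at h1
    rw [hG _ (hD'm.diff hSm), hcompl S hS hSm hSv, h1, hTv] at h2
    have hc0 : c = 0 := by
      -- `S` and `D' \ S` have measures `a - p` and `b - p`, with `p` that of `P`, but equal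
      -- integrals.
      have h3 : c * ((a : ℂ) - b) = 0 := by
        push_cast at h2
        linear_combination h2
      refine (mul_eq_zero.mp h3).resolve_right (sub_ne_zero.mpr ?_)
      exact_mod_cast hab
    have h4 := hc V hV
    rw [hG V hVm, hc0, zero_mul] at h4
    exact sub_eq_zero.mp h4
  obtain ⟨g, hgm, hgi, hg⟩ := hdens U hUm
  have hE : volume.real (D \ U) = b := by
    rw [measureReal_sdiff hUD hUm, hDv, hU]
    ring
  obtain ⟨c, hc⟩ := exists_setIntegral_eq_mul hgm hgi (hD.diff hUm)
    -- By symmetry, `hswap` with `V = U` says that the density of `F U` is constant off `U`.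
    (half_pos (lt_min ha hb)) fun P hP Q hQ hPm hQm hPQ hpq hp => by
      rw [← hg P hPm, ← hg Q hQm, hsymm U, hsymm U]
      refine hswap P (fun x hx => (hP hx).1) Q (fun x hx => (hQ hx).1) hPm hQm hPQ hpq hp U
        (fun x hx => ⟨hUD hx, ?_⟩) hUm
      rintro (h | h)
      · exact (hP h).2 hx
      · exact (hQ h).2 hx
  have hc0 : c = 0 := by
    have := hc (D \ U) subset_rfl
    rw [← hg _ (hD.diff hUm), h0 U hUD hUm hU, hE, eq_comm, mul_eq_zero] at this
    exact this.resolve_right (by exact_mod_cast hb.ne')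
  rw [hg P hPm, hc P hPU, hc0, zero_mul]

/-- Halving serves only to bring the total below one. -/
theorem VanishesOnDisjointProducts.update_half {m : ℕ} {α : Fin m → ℝ} (hα : ∀ i, 0 < α i)
    {f : (Fin m → I) → ℂ} (hf : Integrable f volume) (hsymm : IsSymmetricFun f)
    (hsum : ∑ i, α i = 1) {i j : Fin m} (hij : α i ≠ α j)
    (h : VanishesOnDisjointProducts α f) :
    VanishesOnDisjointProducts (Function.update α j (α j / 2)) f := by
  have hne : i ≠ j := fun h => hij (congrArg α h)
  intro A hA hd hv
  have hpos : ∀ l, 0 ≤ Function.update α j (α j / 2) l := fun l => by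
    rcases eq_or_ne l j with rfl | hl
    · simpa using (half_pos (hα l)).le
    · simpa [hl] using (hα l).le
  have hv' : ∀ l, l ≠ j → volume.real (A l) = α l := fun l hl => by
    have := hpos l
    rw [measureReal_def, hv l, ENNReal.toReal_ofReal this]
    simp [hl]
  let s : Finset (Fin m) := (Finset.univ.erase i).erase j
  have hs : ∀ l, l ∈ s ↔ l ≠ j ∧ l ≠ i := fun l => by simp [s]
  let E : Set I := ⋃ l ∈ s, A l
  have hE : MeasurableSet E := Finset.measurableSet_biUnion _ fun l _ => hA l
  have hEv : volume.real E = ∑ l ∈ s, α l := by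
    rw [measureReal_biUnion_finset (fun k _ l _ hkl => hd k l hkl) fun l _ => hA l]
    exact Finset.sum_congr rfl fun l hl => hv' l ((hs l).mp hl).1
  have hDv : volume.real Eᶜ = α i + α j := by
    rw [probReal_compl_eq_one_sub hE, hEv, ← hsum,
      ← Finset.add_sum_erase Finset.univ α (Finset.mem_univ i),
      ← Finset.add_sum_erase (Finset.univ.erase i) α (a := j) (by simp [hne.symm])]
    ring
  have hdE : ∀ B ⊆ Eᶜ, ∀ l, l ≠ j → l ≠ i → Disjoint B (A l) := fun B hB l hlj hli =>
    Set.disjoint_left.mpr fun x hx hxl =>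
      hB hx (Set.mem_biUnion (Finset.mem_coe.mpr ((hs l).mpr ⟨hlj, hli⟩)) hxl)
  have hEd : ∀ l, (l = j ∨ l = i) → A l ⊆ Eᶜ := fun l hl x hx hxE => by
    obtain ⟨k, hk, hxk⟩ := Set.mem_iUnion₂.mp hxE
    have hk' := (hs k).mp hk
    refine Set.disjoint_left.mp (hd l k ?_) hx hxk
    rintro rfl
    exact hl.elim hk'.1 hk'.2
  let F : Set I → Set I → ℂ := fun B C =>
    ∫ x in Set.univ.pi (Function.update (Function.update A i B) j C), f x
  have hFsymm : ∀ B C, F B C = F C B := fun B C => by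
    simp only [F]
    rw [← hsymm.setIntegral_pi_comp (Equiv.swap i j)]
    congr 3
    ext1 l
    rcases eq_or_ne l i with rfl | hli
    · simp [hne]
    · rcases eq_or_ne l j with rfl | hlj
      · simp [hne]
      · simp [Equiv.swap_apply_of_ne_of_ne hli hlj, hli, hlj]
  have hFA : F (A i) (A j) = ∫ x in Set.univ.pi A, f x := by
    simp [F]
  rw [← hFA]
  refine eq_zero_of_vanishes_on_partitions hE.compl (hα i) (hα j) hij hDv hFsymm
    (fun B hB => hf.exists_setIntegral_pi_update_eq
      (measurableSet_update (fun l _ => hA l) hB) j)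
    (fun B hB hBm hBv => ?_) (hEd i (Or.inr rfl)) (hA i) (hv' i hne)
    (fun x hx => ⟨hEd j (Or.inl rfl) hx, fun hx' => Set.disjoint_left.mp (hd i j hne) hx' hx⟩)
    (hA j)
  refine h.setIntegral_eq_zero
    (measurableSet_update (fun l _ => measurableSet_update (fun l _ => hA l) hBm l)
      (hE.compl.diff hBm))
    (disjoint_update_of_disjoint (fun k l hkl hk hl => ?_) fun l hl => ?_) fun l => ?_
  · rcases eq_or_ne k i with rfl | hki
    · simpa [hkl.symm] using hdE B hB l hl hkl.symm
    · rcases eq_or_ne l i with rfl | hli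
      · simpa [hki] using (hdE B hB k hk hki).symm
      · simpa [hki, hli] using hd k l hkl
  · rcases eq_or_ne l i with rfl | hli
    · simpa using Set.disjoint_sdiff_left
    · simpa [hli] using hdE (Eᶜ \ B) Set.sdiff_subset l hl hli
  · rcases eq_or_ne l j with rfl | hlj
    · rw [Function.update_self, measureReal_sdiff hB hBm, hDv, hBv]
      ring
    · rcases eq_or_ne l i with rfl | hli
      · simpa [hlj] using hBv
      · simpa [hlj, hli] using hv' l hlj

theorem corollary2 {m : ℕ} (α : Fin m → ℝ) (hα : ∀ i, α i ∈ Set.Ioo (0 : ℝ) 1)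
    (f : (Fin m → I) → ℂ) (hf : Integrable f volume) :
    (∑ i, α i < 1 →
      (VanishesOnDisjointProducts α f ↔ f =ᵐ[volume] 0)) ∧
    (IsSymmetricFun f → ∑ i, α i = 1 → α ≠ (fun _ => 1 / (m : ℝ)) →
      (VanishesOnDisjointProducts α f ↔ f =ᵐ[volume] 0)) := by
  have hpos : ∀ i, 0 < α i := fun i => (hα i).1
  refine ⟨fun hsum => ⟨fun h => h.ae_eq_zero hpos hf hsum,
    vanishesOnDisjointProducts_of_ae_eq_zero⟩,
    fun hsymm hsum hne => ⟨fun h => ?_, vanishesOnDisjointProducts_of_ae_eq_zero⟩⟩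
  obtain ⟨i, j, hij⟩ : ∃ i j, α i ≠ α j := by
    by_contra! hconst
    refine hne (funext fun i => ?_)
    have hs : ∑ l, α l = m * α i := by
      rw [Finset.sum_congr rfl fun l _ => hconst l i]
      simp
    rw [hsum] at hs
    exact eq_one_div_of_mul_eq_one_right hs.symm
  refine (h.update_half hpos hf hsymm hsum hij).ae_eq_zero (fun l => ?_) hf ?_
  · rcases eq_or_ne l j with rfl | hl
    · simpa using hpos l
    · simpa [hl] using hpos l
  · rw [Finset.sum_update_of_mem (Finset.mem_univ j)]
    rw [← Finset.add_sum_erase Finset.univ α (Finset.mem_univ j)] at hsum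
    rw [Finset.sdiff_singleton_eq_erase]
    linarith [hpos j]
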